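/- Let $X=\mathbb{R}\times\mathbb{T}$, where $\mathbb{T}$ is the circle group, and let $G$ be the subgroup of $X$ generated by the element of order $2$. Let $Y$ be the character group of $X$, and write $(x,y)$ for the value of $y\in Y$ at $x\in X$. The characteristic function of a probability distribution $\mu$ on $X$ is $\hat\mu(y)=\int_X (x,y)\,d\mu(x)$, $y\in Y$. A probability distribution $\gamma$ on $X$ is called Gaussian if $\hat\gamma(y)=(x,y)\exp\{-\varphi(y)\}$ for all $y\in Y$, where $x\in X$ and $\varphi$ is a continuous nonnegative function on $Y$ satisfying $\varphi(u+v)+\varphi(u-v)=2[\varphi(u)+\varphi(v)]$ for all $u,v\in Y$; it is nondegenerate if it is not concentrated at a single point. The conditional distribution of $L_2$ given $L_1$ is called symmetric if, for almost every value of $L_1$, it is invariant under $x\mapsto -x$. Then there is no topological automorphism $\alpha$ of the group $X$ for which both of the following statements hold. 1. If $\xi_1$ and $\xi_2$ are independent random variables with values in $X$ and distributions $\mu_1$ and $\mu_2$ with nonvanishing characteristic functions, and the conditional distribution of $L_2=\xi_1+\alpha\xi_2$ given $L_1=\xi_1+\xi_2$ is symmetric, then $\mu_j=\gamma_j*\rho_j$,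 $j=1,2$, where $\gamma_j$ are Gaussian distributions on $X$ and $\rho_j$ are probability distributions on $X$ concentrated on $G$. 2. There are independent random variables $\xi_1$ and $\xi_2$ with values in $X$ and distributions $\mu_j=\gamma_j*\rho_j$, $j=1,2$, where $\gamma_j$ are nondegenerate Gaussian distributions on $X$ and $\rho_j$ are probability distributions on $X$ concentrated on $G$, such that the conditional distribution of $L_2=\xi_1+\alpha\xi_2$ given $L_1=\xi_1+\xi_2$ is symmetric. -/

import Mathlib

open MeasureTheory ProbabilityTheory

noncomputable section

namespace Heyde

/-- The group `ℝ × 𝕋`, written additively; `Circle` is the multiplicative group of the complex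
numbers of absolute value one. -/
abbrev RT : Type := ℝ × Additive Circle

/-- The circle group carries its Borel sigma-algebra. -/
instance : MeasurableSpace (Additive Circle) := borel (Additive Circle)

instance : BorelSpace (Additive Circle) := ⟨rfl⟩

instance : PolishSpace (Additive Circle) := inferInstanceAs (PolishSpace Circle)

section General

variable {X : Type*} [AddCommGroup X] [TopologicalSpace X]

variable (X) in
/-- The character group of the additive topological group `X`: the continuous homomorphisms from
`X` to the circle group, with pointwise multiplication and the compact-open topology. -/
abbrev CharGroup : Type _ := PontryaginDual (Multiplicative X)

/-- The value `(x, y)` of the character `y` at `x`. -/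
def pairing (x : X) (y : CharGroup X) : ℂ := ((y (Multiplicative.ofAdd x) : Circle) : ℂ)

variable [MeasurableSpace X]

/-- The characteristic function `y ↦ ∫ (x, y) dμ(x)` of a distribution on `X`. -/
def charFn (μ : Measure X) (y : CharGroup X) : ℂ := ∫ x, pairing x y ∂μ

/-- Gaussian distributions on `X` (degenerate ones included): the characteristic function is
`(x, y) exp (-φ y)` with `φ` continuous, nonnegative and satisfying the parallelogram identity.
The character group is written multiplicatively. -/
def IsGaussianDistribution (γ : Measure X) : Prop :=
  IsProbabilityMeasure γ ∧
    ∃ (x : X) (φ : CharGroup X → ℝ),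
      Continuous φ ∧ (∀ y, 0 ≤ φ y) ∧
      (∀ u v, φ (u * v) + φ (u / v) = 2 * (φ u + φ v)) ∧
      ∀ y, charFn γ y = pairing x y * Complex.exp (-(φ y : ℂ))

/-- A distribution is degenerate if it is concentrated at a single point. -/
def IsDegenerate (γ : Measure X) : Prop := ∃ x : X, γ = Measure.dirac x

/-- Probability distributions on `X` that are concentrated on the subgroup `G`. -/
def IsDistributionOn (G : AddSubgroup X) (ρ : Measure X) : Prop :=
  IsProbabilityMeasure ρ ∧ ρ (G : Set X)ᶜ = 0

variable (X) in
/-- The subgroup generated by the elements of order two. -/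
def orderTwoSubgroup : AddSubgroup X := AddSubgroup.closure {x : X | addOrderOf x = 2}

/-- The conditional distribution of `L₂` given `L₁` is symmetric: for almost every value of `L₁`
it is invariant under `x ↦ -x`. -/
def SymmetricCondDistrib [StandardBorelSpace X] {Ω : Type*} [MeasurableSpace Ω]
    (P : Measure Ω) [IsFiniteMeasure P] (L₂ L₁ : Ω → X) : Prop :=
  ∀ᵐ x ∂(P.map L₁), (condDistrib L₂ L₁ P x).map (fun z => -z) = condDistrib L₂ L₁ P x

end General

end Heyde

end

noncomputable section

namespace Heyde

/-! ### Continuous homomorphisms between the line and the circle -/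

/-! Every topological automorphism of `ℝ × 𝕋` has the form `(t, z) ↦ (a t, exp (i c t) z^{±1})` with
`a ≠ 0` (`exists_automorphism_params`). Statement 1 fails for all of these except the sign `+` with
`a > 0`, and there statement 2 fails.

Sign `-`: on `𝕋` the condition concerns `ξ₁ + ξ₂` and `ξ₁ - ξ₂`, so exchanging i.i.d. summands gives
the symmetry for every common law on `𝕋`; a suitable two-point law contradicts statement 1
(`exists_circle_counterexample`).

Sign `+`, `a < 0`: there is a closed copy of `ℝ × {±1}` on which `α` acts as `(t, η) ↦ (a t, η)`. On
it take densities `g + η h` with `g`, `h` Gaussian of different variances. When the product of the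
two signs is fixed, the mixed terms cancel and the joint density depends on `x² - a y²` only, a form
invariant under the linear map that fixes `x + y` and negates `x + a y` (`mixture_symmetric`). The
two variances show up on different cosets of characters, so such a law is not a Gaussian convolved
with a law on `G` (`mixture_ne_conv`).

Sign `+`, `a > 0`: on squares of characters the factors on `G` disappear from the functional
equation, and the remaining identity between nonnegative quadratic functions forces `φ₂ = 0`
(`isDegenerate_of_symmetric`). -/

theorem exists_eq_circleExp {f : ℝ → Circle} (hf : Continuous f)
    (hadd : ∀ x y, f (x + y) = f x * f y) : ∃ s : ℝ, ∀ t, f t = Circle.exp (s * t) := by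
  have h0 : f 0 = 1 := by simpa using hadd 0 0
  have lift := fun (g : C(ℝ, Circle)) (hg : g 0 = 1) =>
    Circle.isCoveringMap_exp.existsUnique_continuousMap_lifts g 0 0 (by simp [hg])
  obtain ⟨F, ⟨hF0, hF⟩, huniq⟩ := lift ⟨f, hf⟩ h0
  have hF' : ∀ t, Circle.exp (F t) = f t := fun t => congrFun hF t
  have hFadd : ∀ x y, F (x + y) = F x + F y := by
    intro x y
    -- The translate `t ↦ F (x + t) - F x` also lifts `f` and vanishes at `0`, so uniqueness of the
    -- lift makes `F` additive.
    have := huniq ⟨fun t => F (x + t) - F x, by fun_prop⟩ ⟨by simp, by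
      ext1 t
      simp [Circle.exp_sub, hF', hadd]⟩
    have := congrArg (fun G : C(ℝ, ℝ) => G y) this
    simp only [ContinuousMap.coe_mk] at this
    linarith
  let L := AddMonoidHom.toRealLinearMap ⟨⟨F, hF0⟩, hFadd⟩ F.continuous
  refine ⟨F 1, fun t => ?_⟩
  rw [← hF' t]
  have : L (t • (1 : ℝ)) = t • L 1 := L.map_smul t 1
  have h2 : F t = t * F 1 := by simpa [L] using this
  rw [h2, mul_comm]

/-- Pulled back to the line, `h` is `t ↦ exp (i s t)`, and `2π`-periodicity makes `s` an integer
`n`. Injectivity excludes `n = 0`; since `exp (2πi / n)` is in the kernel, it also forces `n = ±1`.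
-/
theorem circle_hom_eq_self_or_inv {h : Circle → Circle} (hc : Continuous h)
    (hmul : ∀ x y, h (x * y) = h x * h y) (hinj : Function.Injective h) :
    (∀ z, h z = z) ∨ ∀ z, h z = z⁻¹ := by
  have h1 : h 1 = 1 := by simpa using hmul 1 1
  obtain ⟨s, hs⟩ := exists_eq_circleExp (f := fun t => h (Circle.exp t)) (by fun_prop)
    (fun x y => by rw [Circle.exp_add, hmul])
  have hpi := hs (2 * Real.pi)
  rw [Circle.exp_two_pi, h1, eq_comm, Circle.exp_eq_one] at hpi
  obtain ⟨n, hn⟩ := hpi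
  have hsn : s = n := mul_right_cancel₀ (by positivity) hn
  have hn0 : n ≠ 0 := by
    rintro rfl
    have := @hinj (Circle.exp 1) 1 (by rw [hs, h1, hsn]; simp)
    rw [Circle.exp_eq_one] at this
    obtain ⟨m, hm⟩ := this
    have hpi3 := Real.pi_gt_three
    rcases le_or_gt m 0 with h | h
    · have : (m : ℝ) ≤ 0 := by exact_mod_cast h
      nlinarith
    · have : (1 : ℝ) ≤ m := by exact_mod_cast h
      nlinarith
  have hk := @hinj (Circle.exp (2 * Real.pi / n)) 1 (by
    rw [hs, h1, hsn, mul_div_cancel₀ _ (by exact_mod_cast hn0), Circle.exp_two_pi])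
  rw [Circle.exp_eq_one] at hk
  obtain ⟨m, hm⟩ := hk
  have hn0' : (n : ℝ) ≠ 0 := by exact_mod_cast hn0
  have hmn : m * n = 1 := by
    have : (m : ℝ) * n = 1 := by
      rw [div_eq_iff hn0'] at hm
      have h2 : (2 * Real.pi) ≠ 0 := by positivity
      apply mul_right_cancel₀ h2
      linarith
    exact_mod_cast this
  rcases Int.eq_one_or_neg_one_of_mul_eq_one' hmn with ⟨-, rfl⟩ | ⟨-, rfl⟩
  · left
    intro z
    obtain ⟨t, rfl⟩ := Circle.exp_surjective z
    simpa [hsn] using hs t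
  · right
    intro z
    obtain ⟨t, rfl⟩ := Circle.exp_surjective z
    simpa [hsn] using hs t

/-- The image is a compact subgroup of the line, and multiples of a nonzero element would be
unbounded. -/
theorem circle_to_real_hom_eq_zero {f : Additive Circle → ℝ} (hf : Continuous f)
    (hadd : ∀ x y, f (x + y) = f x + f y) (z : Additive Circle) : f z = 0 := by
  let F : Additive Circle →+ ℝ := AddMonoidHom.mk' f hadd
  have : CompactSpace (Additive Circle) := inferInstanceAs (CompactSpace Circle)
  obtain ⟨C, hC⟩ := (isCompact_range hf).isBounded.exists_norm_le
  by_contra hz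
  have hz' : 0 < |f z| := abs_pos.mpr hz
  obtain ⟨n, hn⟩ := exists_nat_gt (C / |f z|)
  have h1 := hC _ ⟨n • z, rfl⟩
  have h2 : f (n • z) = n * f z := by rw [← nsmul_eq_mul]; exact map_nsmul F n z
  rw [h2, Real.norm_eq_abs, abs_mul, Nat.abs_cast] at h1
  rw [div_lt_iff₀ hz'] at hn
  linarith

/-- The topological automorphisms of `ℝ × 𝕋`. -/
theorem exists_automorphism_params (α : RT ≃ₜ+ RT) : ∃ a c : ℝ, a ≠ 0 ∧
    (∀ t : ℝ, α (t, 0) = (a * t, Additive.ofMul (Circle.exp (c * t)))) ∧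
    ((∀ z, α (0, z) = (0, z)) ∨ ∀ z, α (0, z) = (0, -z)) := by
  have hαc : Continuous α := α.continuous_toFun
  have hz0 : ∀ z, (α (0, z)).1 = 0 := circle_to_real_hom_eq_zero (by fun_prop) fun x y => by
    rw [← Prod.fst_add, ← map_add]; simp
  let A := AddMonoidHom.toRealLinearMap
    (AddMonoidHom.mk' (fun t : ℝ => (α (t, 0)).1) fun x y => by
      rw [← Prod.fst_add, ← map_add]; simp) (by change Continuous fun t : ℝ => (α (t, 0)).1; fun_prop)
  have hA : ∀ t : ℝ, (α (t, 0)).1 = (α (1, 0)).1 * t := fun t => by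
    have : A (t • (1 : ℝ)) = t • A 1 := A.map_smul t 1
    simpa [A, mul_comm] using this
  obtain ⟨c, hc⟩ := exists_eq_circleExp (f := fun t : ℝ => (α (t, 0)).2.toMul)
    (by exact continuous_toMul.comp (by fun_prop)) (fun x y => by
      rw [← toMul_add, ← Prod.snd_add, ← map_add]; simp)
  refine ⟨(α (1, 0)).1, c, ?_, fun t => ?_, ?_⟩
  · intro h
    obtain ⟨⟨t, z⟩, hx⟩ := α.surjective (1, 0)
    have : ((t, z) : RT) = (t, 0) + (0, z) := by simp
    rw [this, map_add] at hx
    have := congrArg Prod.fst hx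
    rw [Prod.fst_add, hA, hz0, h] at this
    simp at this
  · ext1
    · exact hA t
    · exact congrArg Additive.ofMul (hc t)
  · have key := circle_hom_eq_self_or_inv
      (h := fun z : Circle => (α (0, Additive.ofMul z)).2.toMul)
      (by exact continuous_toMul.comp
            (continuous_snd.comp (hαc.comp (continuous_const.prodMk continuous_ofMul))))
      (fun x y => by rw [← toMul_add, ← Prod.snd_add, ← map_add]; simp)
      (fun x y hxy => by
        have h1 : (α (0, Additive.ofMul x)).2 = (α (0, Additive.ofMul y)).2 :=
          Additive.toMul.injective hxy
        have := α.injective (Prod.ext ((hz0 _).trans (hz0 _).symm) h1)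
        simpa using this)
    refine key.imp (fun h z => ?_) fun h z => ?_
    · exact Prod.ext (hz0 z) (congrArg Additive.ofMul (h z.toMul))
    · exact Prod.ext (hz0 z) (congrArg Additive.ofMul (h z.toMul))

/-! ### Characters and characteristic functions -/

theorem add_self_eq_zero_of_mem_orderTwoSubgroup {X : Type*} [AddCommGroup X] {x : X} (hx : x ∈ orderTwoSubgroup X) :
    x + x = 0 := by
  induction hx using AddSubgroup.closure_induction with
  | mem x hx =>
    rw [← two_nsmul, ← (show addOrderOf x = 2 from hx)]
    exact addOrderOf_nsmul_eq_zero x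
  | zero => simp
  | add x y _ _ hx hy => rw [add_add_add_comm, hx, hy, add_zero]
  | neg x _ hx => rw [← neg_add, hx, neg_zero]

section Pairing

variable {X : Type*} [AddCommGroup X] [TopologicalSpace X]

theorem pairing_add (x x' : X) (y : CharGroup X) :
    pairing (x + x') y = pairing x y * pairing x' y := by
  simp [pairing, ofAdd_add, map_mul]

theorem pairing_zero (y : CharGroup X) : pairing 0 y = 1 := by
  simp [pairing, ofAdd_zero, map_one]

theorem pairing_mul (x : X) (y y' : CharGroup X) :
    pairing x (y * y') = pairing x y * pairing x y' := rfl

theorem pairing_one (x : X) : pairing x (1 : CharGroup X) = 1 := rfl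

theorem pairing_pow (x : X) (y : CharGroup X) (n : ℕ) : pairing x (y ^ n) = pairing x y ^ n := by
  induction n with
  | zero => simp [pairing_one]
  | succ n ih => rw [pow_succ, pairing_mul, ih, pow_succ]

theorem norm_pairing (x : X) (y : CharGroup X) : ‖pairing x y‖ = 1 := Circle.norm_coe _

theorem pairing_ne_zero (x : X) (y : CharGroup X) : pairing x y ≠ 0 := Circle.coe_ne_zero _

theorem pairing_neg (x : X) (y : CharGroup X) : pairing (-x) y = (pairing x y)⁻¹ := by
  refine eq_inv_of_mul_eq_one_left ?_
  rw [← pairing_add, neg_add_cancel, pairing_zero]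

theorem pairing_inv (x : X) (y : CharGroup X) : pairing x y⁻¹ = (pairing x y)⁻¹ := by
  refine eq_inv_of_mul_eq_one_left ?_
  rw [← pairing_mul, inv_mul_cancel, pairing_one]

theorem continuous_pairing (y : CharGroup X) : Continuous fun x : X => pairing x y :=
  continuous_subtype_val.comp ((map_continuous y).comp continuous_ofAdd)

/-- The character with given values. -/
def mkChar (f : X → Circle) (hf : Continuous f) (hadd : ∀ x x', f (x + x') = f x * f x') :
    CharGroup X where
  toFun x := f x.toAdd
  map_one' := by simpa using hadd 0 0
  map_mul' x x' := hadd _ _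
  continuous_toFun := hf.comp continuous_toAdd

/-- The adjoint of a continuous automorphism, acting on characters. -/
def charComp (α : X ≃ₜ+ X) (y : CharGroup X) : CharGroup X :=
  mkChar (fun x => y (Multiplicative.ofAdd (α x)))
    ((map_continuous y).comp (continuous_ofAdd.comp α.continuous_toFun))
    fun x x' => by simp [ofAdd_add]

theorem pairing_charComp (α : X ≃ₜ+ X) (y : CharGroup X) (x : X) :
    pairing x (charComp α y) = pairing (α x) y := rfl

theorem charComp_mul (α : X ≃ₜ+ X) (y y' : CharGroup X) :
    charComp α (y * y') = charComp α y * charComp α y' := rfl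

theorem charGroup_ext {y y' : CharGroup X} (h : ∀ x, pairing x y = pairing x y') : y = y' :=
  PontryaginDual.ext fun x => Circle.ext (h x.toAdd)

theorem pairing_sq_of_mem_orderTwoSubgroup {x : X} (hx : x ∈ orderTwoSubgroup X)
    (y : CharGroup X) : pairing x (y ^ 2) = 1 := by
  rw [sq, pairing_mul, ← pairing_add, add_self_eq_zero_of_mem_orderTwoSubgroup hx, pairing_zero]

end Pairing

section CharFn

variable {X : Type*} [AddCommGroup X] [TopologicalSpace X] [MeasurableSpace X]

theorem charFn_one (μ : Measure X) [IsProbabilityMeasure μ] : charFn μ 1 = 1 := by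
  simp [charFn, pairing_one]

/-- Squares of characters are trivial on elements of order two. Restricting to squares thus isolates
the Gaussian factor in `γ.conv ρ`. -/
theorem charFn_mul_sq {ρ : Measure X} (hρ : IsDistributionOn (orderTwoSubgroup X) ρ)
    (u v : CharGroup X) : charFn ρ (u * v ^ 2) = charFn ρ u := by
  refine integral_congr_ae ?_
  have : ∀ᵐ x ∂ρ, x ∈ (orderTwoSubgroup X : Set X) := hρ.2
  filter_upwards [this] with x hx
  rw [pairing_mul, pairing_sq_of_mem_orderTwoSubgroup hx, mul_one]

theorem charFn_sq {ρ : Measure X} (hρ : IsDistributionOn (orderTwoSubgroup X) ρ)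
    (v : CharGroup X) : charFn ρ (v ^ 2) = 1 := by
  have := hρ.1
  rw [← one_mul (v ^ 2), charFn_mul_sq hρ, charFn_one]

variable [OpensMeasurableSpace X]

theorem integrable_pairing (μ : Measure X) [IsFiniteMeasure μ] [SecondCountableTopology X]
    (y : CharGroup X) : Integrable (fun x => pairing x y) μ :=
  Integrable.of_bound (continuous_pairing y).aestronglyMeasurable 1
    (by simp [norm_pairing])

theorem charFn_conv [SecondCountableTopology X] [MeasurableAdd₂ X] (μ ν : Measure X)
    [IsFiniteMeasure μ] [IsFiniteMeasure ν] (y : CharGroup X) :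
    charFn (μ.conv ν) y = charFn μ y * charFn ν y := by
  unfold charFn
  rw [integral_conv (integrable_pairing _ y)]
  simp_rw [pairing_add, integral_const_mul, integral_mul_const]

end CharFn

/-! ### Gaussian distributions and quadratic functions on the character group -/

section Gaussian

variable {X : Type*} [AddCommGroup X] [TopologicalSpace X]

/-- Nonnegative continuous functions on the character group satisfying the parallelogram law. -/
structure IsQuadratic (φ : CharGroup X → ℝ) : Prop where
  continuous : Continuous φ
  nonneg : ∀ y, 0 ≤ φ y
  parallelogram : ∀ u v, φ (u * v) + φ (u / v) = 2 * (φ u + φ v)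

namespace IsQuadratic

variable {φ : CharGroup X → ℝ}

theorem map_one (h : IsQuadratic φ) : φ 1 = 0 := by
  have := h.parallelogram 1 1
  simp only [mul_one, div_one] at this
  linarith

theorem map_inv (h : IsQuadratic φ) (u : CharGroup X) : φ u⁻¹ = φ u := by
  have := h.parallelogram 1 u
  simp only [one_mul, one_div, h.map_one] at this
  linarith

theorem map_pow (h : IsQuadratic φ) (u : CharGroup X) (n : ℕ) : φ (u ^ n) = n ^ 2 * φ u := by
  induction n using Nat.twoStepInduction with
  | zero => simp [h.map_one]
  | one => simp
  | more n ih1 ih2 =>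
    have := h.parallelogram (u ^ (n + 1)) u
    rw [← pow_succ, pow_succ u n, mul_div_cancel_right, ih1, ← pow_succ, ih2] at this
    push_cast at this ⊢
    linarith

theorem map_zpow (h : IsQuadratic φ) (u : CharGroup X) (n : ℤ) : φ (u ^ n) = n ^ 2 * φ u := by
  obtain ⟨m, rfl | rfl⟩ := n.eq_nat_or_neg
  · simpa using h.map_pow u m
  · simpa [h.map_inv] using h.map_pow u m

/-- Homogeneity under integer powers gives the formula at rational `s`; continuity and density give
the rest. -/
theorem map_oneParameter (h : IsQuadratic φ) {w : ℝ → CharGroup X} (hw : Continuous w)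
    (hadd : ∀ s t, w (s + t) = w s * w t) (s : ℝ) : φ (w s) = s ^ 2 * φ (w 1) := by
  let W : Multiplicative ℝ →* CharGroup X := 
    MonoidHom.mk' (fun s => w s.toAdd) fun s t => hadd _ _
  have hpow : ∀ (n : ℤ) (s : ℝ), w (n * s) = w s ^ n := fun n s => by
    rw [← zsmul_eq_mul]
    exact _root_.map_zpow W (Multiplicative.ofAdd s) n
  have hrat : (fun s => φ (w s)) ∘ ((↑) : ℚ → ℝ) = (fun s => s ^ 2 * φ (w 1)) ∘ ((↑) : ℚ → ℝ) := by
    ext1 q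
    have hq : (q.den : ℝ) ≠ 0 := by exact_mod_cast q.den_ne_zero
    have hnum : (q.num : ℝ) = q.den * (q : ℝ) := by
      exact_mod_cast (q.den_mul_eq_num).symm
    have h1 := h.map_zpow (w q) q.den
    have h2 := h.map_zpow (w 1) q.num
    rw [← hpow] at h1 h2
    push_cast at h1
    rw [mul_one, hnum, h1] at h2
    simp only [Function.comp_apply]
    apply mul_left_cancel₀ (pow_ne_zero 2 hq)
    rw [h2]
    ring
  exact congrFun (Rat.denseRange_cast.equalizer (h.continuous.comp hw) (by fun_prop) hrat) s

end IsQuadratic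

theorem IsGaussianDistribution.exists_quadratic [MeasurableSpace X] {γ : Measure X}
    (hγ : IsGaussianDistribution γ) : ∃ (x : X) (φ : CharGroup X → ℝ), IsQuadratic φ ∧
      ∀ y, charFn γ y = pairing x y * Complex.exp (-(φ y : ℂ)) :=
  let ⟨x, φ, hc, hn, hp, h⟩ := hγ.2
  ⟨x, φ, ⟨hc, hn, hp⟩, h⟩

theorem norm_pairing_mul_exp_neg (x : X) (y : CharGroup X) (r : ℝ) :
    ‖pairing x y * Complex.exp (-(r : ℂ))‖ = Real.exp (-r) := by
  rw [norm_mul, norm_pairing, one_mul, ← Complex.ofReal_neg, Complex.norm_exp_ofReal]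

/-- The parallelogram identity for the modulus of the characteristic function of the convolution of
a Gaussian distribution with a distribution on the subgroup generated by elements of order two. -/
theorem norm_charFn_conv_parallelogram [MeasurableSpace X] [OpensMeasurableSpace X]
    [SecondCountableTopology X] [MeasurableAdd₂ X] {γ ρ : Measure X}
    (hγ : IsGaussianDistribution γ) (hρ : IsDistributionOn (orderTwoSubgroup X) ρ)
    (u v : CharGroup X) :
    ‖charFn (γ.conv ρ) (u * v ^ 2)‖ * ‖charFn (γ.conv ρ) (u / v ^ 2)‖ =
      ‖charFn (γ.conv ρ) u‖ ^ 2 * ‖charFn (γ.conv ρ) (v ^ 2)‖ ^ 2 := by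
  have := hγ.1
  have := hρ.1
  obtain ⟨x, φ, hφ, h⟩ := hγ.exists_quadratic
  simp only [charFn_conv, norm_mul, h, norm_pairing, one_mul, ← Complex.ofReal_neg,
    Complex.norm_exp_ofReal]
  have hinv : u / v ^ 2 = u * v⁻¹ ^ 2 := by rw [div_eq_mul_inv, inv_pow]
  have hE : Real.exp (-φ (u * v ^ 2)) * Real.exp (-φ (u / v ^ 2)) =
      Real.exp (-φ u) ^ 2 * Real.exp (-φ (v ^ 2)) ^ 2 := by
    simp only [← Real.exp_add, ← Real.exp_nat_mul]
    congr 1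
    have := hφ.parallelogram u (v ^ 2)
    push_cast
    linarith
  rw [charFn_sq hρ, charFn_mul_sq hρ, hinv, charFn_mul_sq hρ, ← hinv, norm_one, mul_one,
    mul_mul_mul_comm, hE]
  ring

end Gaussian

/-! ### Symmetry of the conditional distribution as an identity of joint laws -/

section Symmetric

variable {X : Type*} [AddCommGroup X] [MeasurableSpace X] [StandardBorelSpace X]
  [MeasurableNeg X]

/-- Both joint laws disintegrate over the law of `L₁`, one with the conditional kernel and the other
with its reflection; kernels in a disintegration are almost everywhere unique. -/
theorem symmetricCondDistrib_iff {Ω : Type*} [MeasurableSpace Ω] (P : Measure Ω)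
    [IsFiniteMeasure P] {L₂ L₁ : Ω → X} (h₂ : Measurable L₂) :
    SymmetricCondDistrib P L₂ L₁ ↔
      P.map (fun ω => (L₁ ω, L₂ ω)) = P.map (fun ω => (L₁ ω, -L₂ ω)) := by
  have h1 : condDistrib (fun ω => -L₂ ω) L₁ P =ᵐ[P.map L₁]
      (condDistrib L₂ L₁ P).map fun z => -z :=
    condDistrib_comp L₁ h₂.aemeasurable measurable_neg
  have h2 : P.map L₁ ⊗ₘ condDistrib (fun ω => -L₂ ω) L₁ P = P.map fun ω => (L₁ ω, -L₂ ω) :=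
    compProd_map_condDistrib (by fun_prop)
  rw [← h2, Measure.compProd_congr h1,
    ← condDistrib_ae_eq_iff_measure_eq_compProd L₁ h₂.aemeasurable]
  refine Filter.eventually_congr (Filter.Eventually.of_forall fun x => ?_)
  rw [Kernel.map_apply _ measurable_neg, eq_comm]

end Symmetric

/-! ### Characters of `ℝ × 𝕋` -/

/-- The character `(t, z) ↦ exp (i s t)`. -/
def lineChar (s : ℝ) : CharGroup RT :=
  mkChar (fun x => Circle.exp (s * x.1)) (by fun_prop) fun x x' => by
    rw [Prod.fst_add, mul_add, Circle.exp_add]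

/-- The character `(t, z) ↦ z exp (-i d t)`. -/
def twistChar (d : ℝ) : CharGroup RT :=
  mkChar (fun x => x.2.toMul * Circle.exp (-(d * x.1)))
    ((continuous_toMul.comp continuous_snd).mul (by fun_prop)) fun x x' => by
      rw [Prod.fst_add, Prod.snd_add, mul_add, neg_add, Circle.exp_add, toMul_add,
        mul_mul_mul_comm]

theorem pairing_lineChar (s : ℝ) (x : RT) : pairing x (lineChar s) = Circle.exp (s * x.1) := rfl

theorem pairing_twistChar (d : ℝ) (x : RT) :
    pairing x (twistChar d) = x.2.toMul * Circle.exp (-(d * x.1)) := by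
  rw [← Circle.coe_mul]; rfl

theorem lineChar_add (s t : ℝ) : lineChar (s + t) = lineChar s * lineChar t :=
  charGroup_ext fun x => by
    rw [pairing_mul]
    simp only [pairing_lineChar, add_mul, Circle.exp_add, Circle.coe_mul]

theorem continuous_lineChar : Continuous lineChar :=
  ContinuousMonoidHom.continuous_of_continuous_uncurry
    (B := Multiplicative RT) (C := Circle) lineChar (by
      change Continuous fun p : ℝ × Multiplicative RT => Circle.exp (p.1 * p.2.toAdd.1)
      have : Continuous fun p : ℝ × Multiplicative RT => p.2.toAdd.1 :=
        continuous_fst.comp (continuous_toAdd.comp continuous_snd)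
      fun_prop)

/-- A character of `ℝ × 𝕋` that is trivial on `𝕋` is of the form `(t, z) ↦ exp (i s t)`. -/
theorem exists_eq_lineChar {y : CharGroup RT} (hy : ∀ z, pairing ((0, z) : RT) y = 1) :
    ∃ s, y = lineChar s := by
  obtain ⟨s, hs⟩ := exists_eq_circleExp (f := fun t : ℝ => y (Multiplicative.ofAdd ((t, 0) : RT)))
    ((map_continuous y).comp (continuous_ofAdd.comp (by fun_prop)))
    (fun x x' => by rw [← map_mul, ← ofAdd_add]; simp)
  refine ⟨s, charGroup_ext fun x => ?_⟩
  have hx : x = (x.1, 0) + (0, x.2) := by simp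
  conv_lhs => rw [hx]
  rw [pairing_add, hy, mul_one, pairing_lineChar, ← hs]
  rfl

/-! ### Degenerate distributions -/

/-- The real part is at most one and has mean one. -/
theorem ae_eq_one_of_integral_eq_one {Ω : Type*} [MeasurableSpace Ω] {P : Measure Ω}
    [IsProbabilityMeasure P] {g : Ω → ℂ} (hg : Integrable g P) (hn : ∀ ω, ‖g ω‖ = 1)
    (h : ∫ ω, g ω ∂P = 1) : ∀ᵐ ω ∂P, g ω = 1 := by
  have hle : ∀ ω, (g ω).re ≤ 1 := fun ω => (Complex.re_le_norm _).trans (hn ω).le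
  have h0 : ∫ ω, (1 - (g ω).re) ∂P = 0 := by
    have hre := integral_re (𝕜 := ℂ) hg
    have hsub := integral_sub (integrable_const (1 : ℝ)) hg.re
    simp only [RCLike.re_to_complex] at hre hsub
    rw [hsub, hre, h]
    simp
  rw [integral_eq_zero_iff_of_nonneg (fun ω => sub_nonneg.mpr (hle ω))
    ((integrable_const _).sub hg.re)] at h0
  filter_upwards [h0] with ω hω
  have hre : (g ω).re = 1 := (sub_eq_zero.mp hω).symm
  have hsq := Complex.sq_norm_sub_sq_re (g ω)
  rw [hn, hre] at hsq
  exact Complex.ext hre (by simpa using hsq.symm)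

theorem isDegenerate_of_charFn_eq_pairing {γ : Measure RT} [IsProbabilityMeasure γ] {x₀ : RT}
    (h : ∀ y, charFn γ y = pairing x₀ y) : IsDegenerate γ := by
  have key : ∀ y, ∀ᵐ x ∂γ, pairing x y = pairing x₀ y := fun y => by
    have := ae_eq_one_of_integral_eq_one (P := γ) (g := fun x => pairing x y * (pairing x₀ y)⁻¹)
      ((integrable_pairing γ y).mul_const _) (fun x => by simp [norm_pairing]) (by
        rw [integral_mul_const]
        change charFn γ y * _ = 1
        rw [h, mul_inv_cancel₀ (pairing_ne_zero _ _)])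
    filter_upwards [this] with x hx
    exact (mul_inv_eq_one₀ (pairing_ne_zero _ _)).mp hx
  have hx : ∀ᵐ x ∂γ, x = x₀ := by
    -- Three characters separate points, so only three null sets arise: frequencies `1` and `√2`
    -- determine the real coordinate because `√2` is irrational, and `twistChar 0` reads off the
    -- circle coordinate.
    filter_upwards [key (lineChar 1), key (lineChar √2), key (twistChar 0)] with x h1 h2 h3
    simp only [pairing_lineChar, pairing_twistChar, Circle.coe_inj, one_mul] at h1 h2 h3
    rw [Circle.exp_eq_exp] at h1 h2
    obtain ⟨n, hn⟩ := h1
    obtain ⟨m, hm⟩ := h2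
    have hmn : √2 * n = m := by
      apply mul_right_cancel₀ (b := 2 * Real.pi) (by positivity)
      rw [hn] at hm
      linarith
    have hn0 : n = 0 := by
      by_contra hn0
      refine (irrational_sqrt_two.mul_intCast hn0).ne_int m hmn
    ext1
    · simpa [hn0] using hn
    · simpa [← Circle.coe_mul, Circle.coe_inj] using h3
  refine ⟨x₀, ?_⟩
  rw [← Measure.map_id (μ := γ), Measure.map_congr (f := id) (g := fun _ => x₀) hx,
    Measure.map_const, measure_univ, one_smul]

/-! ### The functional equation -/

theorem symmetricCondDistrib_iff_prod {Ω : Type*} [MeasurableSpace Ω] (P : Measure Ω)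
    [IsProbabilityMeasure P] (α : RT ≃ₜ+ RT) {ξ₁ ξ₂ : Ω → RT} (h₁ : Measurable ξ₁)
    (h₂ : Measurable ξ₂) (hind : IndepFun ξ₁ ξ₂ P) :
    SymmetricCondDistrib P (fun ω => ξ₁ ω + α (ξ₂ ω)) (fun ω => ξ₁ ω + ξ₂ ω) ↔
      ((P.map ξ₁).prod (P.map ξ₂)).map (fun p => (p.1 + p.2, p.1 + α p.2)) =
        ((P.map ξ₁).prod (P.map ξ₂)).map (fun p => (p.1 + p.2, -(p.1 + α p.2))) := by
  have hα : Measurable α := (map_continuous α).measurable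
  rw [symmetricCondDistrib_iff P (by fun_prop),
    ← (indepFun_iff_map_prod_eq_prod_map_map h₁.aemeasurable h₂.aemeasurable).mp hind,
    Measure.map_map (by fun_prop) (by fun_prop), Measure.map_map (by fun_prop) (by fun_prop)]
  rfl

/-- Integrate the character `(u, v)` of the product group against both joint laws and factor by
independence. -/
theorem charFn_functional_equation {μ₁ μ₂ : Measure RT} [IsProbabilityMeasure μ₁]
    [IsProbabilityMeasure μ₂] {α : RT ≃ₜ+ RT}
    (h : (μ₁.prod μ₂).map (fun p => (p.1 + p.2, p.1 + α p.2)) =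
        (μ₁.prod μ₂).map (fun p => (p.1 + p.2, -(p.1 + α p.2)))) (u v : CharGroup RT) :
    charFn μ₁ (u * v) * charFn μ₂ (u * charComp α v) =
      charFn μ₁ (u / v) * charFn μ₂ (u / charComp α v) := by
  have hα : Measurable α := (map_continuous α).measurable
  have hc : Continuous fun q : RT × RT => pairing q.1 u * pairing q.2 v :=
    ((continuous_pairing u).comp continuous_fst).mul ((continuous_pairing v).comp continuous_snd)
  have := congrArg (fun Q : Measure (RT × RT) => ∫ q, pairing q.1 u * pairing q.2 v ∂Q) h
  beta_reduce at this
  rw [integral_map (by fun_prop) hc.aestronglyMeasurable,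
    integral_map (by fun_prop) hc.aestronglyMeasurable] at this
  have hprod : ∀ y₁ y₂, charFn μ₁ y₁ * charFn μ₂ y₂ =
      ∫ p, pairing p.1 y₁ * pairing p.2 y₂ ∂(μ₁.prod μ₂) := fun _ _ =>
    (integral_prod_mul _ _).symm
  rw [hprod, hprod]
  refine Eq.trans ?_ (this.trans ?_) <;> refine integral_congr_ae (.of_forall fun p => ?_)
  · simp only [pairing_mul, pairing_add, pairing_charComp]
    ring
  · simp only [div_eq_mul_inv, pairing_mul, pairing_add, pairing_neg, pairing_inv,
      pairing_charComp, mul_inv]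
    ring

/-- If `α` acts identically on `𝕋` and by a positive multiplication on `ℝ`, the symmetry of the
conditional distribution forces the second Gaussian distribution to be degenerate. -/
theorem isDegenerate_of_symmetric {α : RT ≃ₜ+ RT} {a c : ℝ} (ha : 0 < a)
    (hline : ∀ t : ℝ, α (t, 0) = (a * t, Additive.ofMul (Circle.exp (c * t))))
    (hcirc : ∀ z, α (0, z) = (0, z)) {γ₁ γ₂ ρ₁ ρ₂ : Measure RT}
    (hγ₁ : IsGaussianDistribution γ₁) (hγ₂ : IsGaussianDistribution γ₂)
    (hρ₁ : IsDistributionOn (orderTwoSubgroup RT) ρ₁)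
    (hρ₂ : IsDistributionOn (orderTwoSubgroup RT) ρ₂)
    (h : ((γ₁.conv ρ₁).prod (γ₂.conv ρ₂)).map (fun p => (p.1 + p.2, p.1 + α p.2)) =
        ((γ₁.conv ρ₁).prod (γ₂.conv ρ₂)).map (fun p => (p.1 + p.2, -(p.1 + α p.2)))) :
    IsDegenerate γ₂ := by
  have := hγ₁.1
  have := hγ₂.1
  have := hρ₁.1
  have := hρ₂.1
  obtain ⟨x₁, φ₁, hφ₁, hf₁⟩ := hγ₁.exists_quadratic
  obtain ⟨x₂, φ₂, hφ₂, hf₂⟩ := hγ₂.exists_quadratic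
  have norm_sq : ∀ {γ ρ : Measure RT} {x : RT} {φ : CharGroup RT → ℝ}, IsGaussianDistribution γ →
      IsDistributionOn (orderTwoSubgroup RT) ρ → IsQuadratic φ →
      (∀ y, charFn γ y = pairing x y * Complex.exp (-(φ y : ℂ))) →
      ∀ y, ‖charFn (γ.conv ρ) (y ^ 2)‖ = Real.exp (-(4 * φ y)) := by
    intro γ ρ x φ hγ hρ hφ hf y
    have := hγ.1
    have := hρ.1
    rw [charFn_conv, charFn_sq hρ, mul_one, hf, norm_pairing_mul_exp_neg, hφ.map_pow]
    norm_num
  -- Moduli of the functional equation at `(u², u²)`: all arguments are squares, and on the right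
  -- the argument of the first factor is trivial.
  have eqn : ∀ u, 4 * φ₁ u + φ₂ (u * charComp α u) = φ₂ (u / charComp α u) := fun u => by
    have := congrArg norm (charFn_functional_equation h (u ^ 2) (u ^ 2))
    have hsq : charComp α (u ^ 2) = charComp α u ^ 2 := by rw [sq, charComp_mul, sq]
    rw [norm_mul, norm_mul, hsq, ← mul_pow, ← mul_pow, ← div_pow, ← div_pow,
      norm_sq hγ₁ hρ₁ hφ₁ hf₁, norm_sq hγ₁ hρ₁ hφ₁ hf₁, norm_sq hγ₂ hρ₂ hφ₂ hf₂,
      norm_sq hγ₂ hρ₂ hφ₂ hf₂, ← Real.exp_add, ← Real.exp_add, Real.exp_eq_exp, div_self',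
      hφ₁.map_one, ← sq, hφ₁.map_pow] at this
    push_cast at this
    linarith
  have hα : ∀ x, α x = α (x.1, 0) + α (0, x.2) := fun x => by
    rw [← map_add]; simp
  have hadj : ∀ s, charComp α (lineChar s) = lineChar (a * s) := fun s => charGroup_ext fun x => by
    have : (α x).1 = a * x.1 := by rw [hα, hline, hcirc]; simp
    rw [pairing_charComp, pairing_lineChar, pairing_lineChar, this]
    ring_nf
  have hquad : ∀ {φ : CharGroup RT → ℝ}, IsQuadratic φ → ∀ s,
      φ (lineChar s) = s ^ 2 * φ (lineChar 1) := fun hφ =>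
    hφ.map_oneParameter continuous_lineChar lineChar_add
  have hzero : ∀ s, φ₂ (lineChar s) = 0 := fun s => by
    have h1 := eqn (lineChar 1)
    have hdiv : lineChar 1 / lineChar a = lineChar (1 - a) := by
      rw [div_eq_iff_eq_mul, ← lineChar_add, sub_add_cancel]
    rw [hadj, mul_one, ← lineChar_add, hdiv, hquad hφ₂ (1 + a), hquad hφ₂ (1 - a)] at h1
    -- This comes from `(1 - a)² - (1 + a)² = -4a`. Both terms are nonnegative because `a > 0`, so
    -- both vanish.
    have h2 : φ₁ (lineChar 1) + a * φ₂ (lineChar 1) = 0 := by linarith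
    have h3 := hφ₁.nonneg (lineChar 1)
    have h4 := mul_nonneg ha.le (hφ₂.nonneg (lineChar 1))
    have h5 : φ₂ (lineChar 1) = 0 :=
      (mul_eq_zero.mp (by linarith : a * φ₂ (lineChar 1) = 0)).resolve_left ha.ne'
    rw [hquad hφ₂, h5, mul_zero]
  have hφ₂0 : ∀ y, φ₂ y = 0 := fun y => by
    -- Since `α` fixes `𝕋` pointwise, `y` and its adjoint image differ by a character of the line,
    -- where `φ₂` is already zero. Then `eqn` gives `φ₂ (y * charComp α y) = 0`, and the
    -- parallelogram identity carries this to `y ^ 2`.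
    obtain ⟨s, hs⟩ := exists_eq_lineChar (y := charComp α y / y) fun z => by
      rw [div_eq_mul_inv, pairing_mul, pairing_charComp, hcirc, pairing_inv,
        mul_inv_cancel₀ (pairing_ne_zero _ _)]
    have h1 := eqn y
    rw [← inv_div (charComp α y) y, hφ₂.map_inv, hs, hzero] at h1
    have h2 := hφ₁.nonneg y
    have h3 := hφ₂.nonneg (y * charComp α y)
    have h4 := hφ₂.parallelogram (y * charComp α y) (lineChar s)
    have h5 : y * charComp α y / lineChar s = y ^ 2 := by
      rw [← hs, div_div_eq_mul_div, mul_right_comm, mul_div_cancel_right, sq]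
    rw [h5, hzero, hφ₂.map_pow] at h4
    have h6 := hφ₂.nonneg (y * charComp α y * lineChar s)
    have h7 := hφ₂.nonneg y
    push_cast at h4
    linarith
  exact isDegenerate_of_charFn_eq_pairing (x₀ := x₂) fun y => by rw [hf₂, hφ₂0]; simp

/-! ### A two-point distribution on the circle -/

/-- The distribution with mass `2/3` at the origin and mass `1/3` at `x`. -/
def twoPoint (x : RT) : Measure RT :=
  ENNReal.ofReal (2 / 3) • Measure.dirac 0 + ENNReal.ofReal (1 / 3) • Measure.dirac x

instance (x : RT) : IsProbabilityMeasure (twoPoint x) := ⟨by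
  simp only [twoPoint, Measure.add_apply, Measure.smul_apply, measure_univ, smul_eq_mul, mul_one]
  rw [← ENNReal.ofReal_add (by norm_num) (by norm_num)]
  norm_num⟩

theorem charFn_twoPoint (x : RT) (y : CharGroup RT) :
    charFn (twoPoint x) y = 2 / 3 + 1 / 3 * pairing x y := by
  have h : ∀ (r : ℝ) (x : RT), Integrable (fun x => pairing x y)
      (ENNReal.ofReal r • Measure.dirac x) := fun r x =>
    (integrable_pairing _ y).smul_measure ENNReal.ofReal_ne_top
  rw [charFn, twoPoint, integral_add_measure (h _ _) (h _ _), integral_smul_measure,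
    integral_smul_measure, integral_dirac, integral_dirac, pairing_zero]
  norm_num

theorem charFn_twoPoint_ne_zero (x : RT) (y : CharGroup RT) : charFn (twoPoint x) y ≠ 0 := by
  intro h
  rw [charFn_twoPoint] at h
  have h1 : pairing x y = -2 := by linear_combination 3 * h
  have h2 := norm_pairing x y
  rw [h1] at h2
  norm_num at h2

theorem ae_twoPoint {x : RT} {p : RT → Prop} (h0 : p 0) (hx : p x)
    (hp : MeasurableSet {x | p x}) : ∀ᵐ x ∂(twoPoint x), p x := by
  rw [twoPoint, ae_add_measure_iff]
  exact ⟨Measure.ae_smul_measure ((ae_dirac_iff hp).mpr h0) _,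
    Measure.ae_smul_measure ((ae_dirac_iff hp).mpr hx) _⟩

/-- If `α` acts as the inversion on `𝕋`, equally distributed independent summands with values
in `𝕋` satisfy the symmetry condition, whatever their distribution is. -/
theorem exists_circle_counterexample {α : RT ≃ₜ+ RT} (hα : ∀ z, α (0, z) = (0, -z)) :
    ∃ μ : Measure RT, IsProbabilityMeasure μ ∧ (∀ y, charFn μ y ≠ 0) ∧
      (μ.prod μ).map (fun p => (p.1 + p.2, p.1 + α p.2)) =
        (μ.prod μ).map (fun p => (p.1 + p.2, -(p.1 + α p.2))) ∧
      ∀ γ ρ, IsGaussianDistribution γ → IsDistributionOn (orderTwoSubgroup RT) ρ →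
        μ ≠ γ.conv ρ := by
  have hαm : Measurable α := (map_continuous α).measurable
  let x₀ : RT := (0, Additive.ofMul (Circle.exp (Real.pi / 2)))
  have hval : ∀ n : ℕ, pairing x₀ (twistChar 0 ^ n) = Complex.I ^ n := fun n => by
    rw [pairing_pow, pairing_twistChar]
    simp [x₀, Circle.coe_exp]
  refine ⟨twoPoint x₀, inferInstance, charFn_twoPoint_ne_zero x₀, ?_, ?_⟩
  · have hae : ∀ᵐ x ∂(twoPoint x₀), α x = -x :=
      ae_twoPoint (by simp) ((hα _).trans (by simp [x₀]))
        (measurableSet_eq_fun hαm measurable_neg)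
    have h1 := (Measure.quasiMeasurePreserving_fst (μ := twoPoint x₀) (ν := twoPoint x₀)).ae hae
    have h2 := (Measure.quasiMeasurePreserving_snd (μ := twoPoint x₀) (ν := twoPoint x₀)).ae hae
    -- Almost surely `α x = -x`, so exchanging the two equally distributed coordinates negates the
    -- second sum and preserves the first.
    conv_lhs => rw [← Measure.prod_swap, Measure.map_map (by fun_prop) measurable_swap]
    refine Measure.map_congr ?_
    filter_upwards [h1, h2] with p hp1 hp2
    simp only [Function.comp_apply, Prod.fst_swap, Prod.snd_swap, hp1, hp2, Prod.mk.injEq]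
    constructor <;> abel
  · intro γ ρ hγ hρ h
    -- The atom `x₀` has order four. With `v = twistChar 0` and `u = v²` the left side is `1` and
    -- the right side is `(1/3)^4`.
    have key := norm_charFn_conv_parallelogram hγ hρ (twistChar 0 ^ 2) (twistChar 0)
    have h2 : charFn (twoPoint x₀) (twistChar 0 ^ 2) = ((1 / 3 : ℝ) : ℂ) := by
      rw [charFn_twoPoint, hval, Complex.I_sq]; norm_num
    have h4 : charFn (twoPoint x₀) (twistChar 0 ^ 2 * twistChar 0 ^ 2) = 1 := by
      rw [charFn_twoPoint, ← pow_add, hval, Complex.I_pow_four]; norm_num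
    rw [← h, div_self', charFn_one, h2, h4, Complex.norm_real] at key
    norm_num at key

/-! ### Mixtures on the line times the subgroup of order two -/

/-- The element of order two of the circle. -/
def circleNegOne : Circle := Circle.exp Real.pi

theorem circleNegOne_mul_self : circleNegOne * circleNegOne = 1 := by
  rw [circleNegOne, ← Circle.exp_add, ← two_mul, Circle.exp_two_pi]

theorem coe_circleNegOne : (circleNegOne : ℂ) = -1 := by
  simp [circleNegOne, Circle.coe_exp]

/-- The map `t ↦ (t, z exp (i d t))`. -/
def embed (d : ℝ) (z : Circle) (t : ℝ) : RT := (t, Additive.ofMul (z * Circle.exp (d * t)))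

theorem continuous_embed (d : ℝ) (z : Circle) : Continuous (embed d z) :=
  continuous_id.prodMk (continuous_ofMul.comp (by fun_prop))

@[fun_prop]
theorem measurable_embed (d : ℝ) (z : Circle) : Measurable (embed d z) :=
  (continuous_embed d z).measurable

theorem embed_add (d : ℝ) (z w : Circle) (s t : ℝ) :
    embed d z s + embed d w t = embed d (z * w) (s + t) := by
  simp only [embed, Prod.mk_add_mk, ← ofMul_mul, mul_add, Circle.exp_add]
  rw [mul_mul_mul_comm]

theorem neg_embed (d : ℝ) {z : Circle} (hz : z * z = 1) (t : ℝ) :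
    -embed d z t = embed d z (-t) := by
  rw [neg_eq_iff_add_eq_zero, embed_add, hz]
  simp [embed]

/-- The condition `c + d = d * a` says exactly that `α` maps the curve `t ↦ (t, exp (i d t))` into
itself. -/
theorem automorphism_embed {α : RT ≃ₜ+ RT} {a c d : ℝ}
    (hline : ∀ t : ℝ, α (t, 0) = (a * t, Additive.ofMul (Circle.exp (c * t))))
    (hcirc : ∀ z, α (0, z) = (0, z)) (hd : c + d = d * a) (z : Circle) (t : ℝ) :
    α (embed d z t) = embed d z (a * t) := by
  have h : embed d z t = (t, 0) + (0, Additive.ofMul (z * Circle.exp (d * t))) := by simp [embed]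
  rw [h, map_add, hline, hcirc, Prod.mk_add_mk, add_zero, ← ofMul_mul, embed, mul_left_comm,
    ← Circle.exp_add, ← add_mul, hd, mul_assoc]

/-- The density `(√(b/π)/2) (exp (-b t²) + ε exp (-2 b t²))`. -/
def mixDensity (b ε t : ℝ) : ℝ :=
  √(b / Real.pi) / 2 * (Real.exp (-b * t ^ 2) + ε * Real.exp (-(2 * b) * t ^ 2))

theorem continuous_mixDensity (b ε : ℝ) : Continuous (mixDensity b ε) := by
  unfold mixDensity; fun_prop

@[fun_prop]
theorem measurable_mixDensity (b ε : ℝ) : Measurable (mixDensity b ε) :=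
  (continuous_mixDensity b ε).measurable

theorem mixDensity_nonneg {b ε : ℝ} (hb : 0 < b) (hε : -1 ≤ ε) (t : ℝ) : 0 ≤ mixDensity b ε t := by
  have h : Real.exp (-(2 * b) * t ^ 2) ≤ Real.exp (-b * t ^ 2) :=
    Real.exp_le_exp.mpr (by nlinarith [sq_nonneg t])
  have h0 := Real.exp_pos (-(2 * b) * t ^ 2)
  exact mul_nonneg (by positivity) (by nlinarith)

theorem integrable_mixDensity {b : ℝ} (hb : 0 < b) (ε : ℝ) : Integrable (mixDensity b ε) :=
  ((integrable_exp_neg_mul_sq hb).add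
    ((integrable_exp_neg_mul_sq (by positivity : 0 < 2 * b)).const_mul ε)).const_mul _

/-- The measure on the line with density `mixDensity b ε`. -/
def mixMeasure (b ε : ℝ) : Measure ℝ :=
  volume.withDensity fun t => ENNReal.ofReal (mixDensity b ε t)

theorem isFiniteMeasure_mixMeasure {b : ℝ} (hb : 0 < b) (ε : ℝ) : IsFiniteMeasure (mixMeasure b ε) :=
  isFiniteMeasure_withDensity_ofReal (integrable_mixDensity hb ε).2

/-- The distribution on `ℝ × 𝕋` carried by the two curves `t ↦ (t, ± exp (i d t))`. -/
def mixture (b d : ℝ) : Measure RT :=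
  (mixMeasure b 1).map (embed d 1) + (mixMeasure b (-1)).map (embed d circleNegOne)

theorem isProbabilityMeasure_mixture {b : ℝ} (hb : 0 < b) (d : ℝ) :
    IsProbabilityMeasure (mixture b d) := ⟨by
  rw [mixture, Measure.add_apply, Measure.map_apply (by fun_prop) .univ,
    Measure.map_apply (by fun_prop) .univ, Set.preimage_univ, Set.preimage_univ, mixMeasure,
    mixMeasure, withDensity_apply _ .univ, withDensity_apply _ .univ, Measure.restrict_univ,
    ← lintegral_add_left (by fun_prop)]
  simp_rw [← ENNReal.ofReal_add (mixDensity_nonneg hb (by norm_num : (-1 : ℝ) ≤ 1) _)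
    (mixDensity_nonneg hb le_rfl _)]
  -- The `exp (-2 b t²)` terms cancel between the two curves, leaving a normalized Gaussian density.
  have h : ∀ t, mixDensity b 1 t + mixDensity b (-1) t =
      √(b / Real.pi) * Real.exp (-b * t ^ 2) := fun t => by unfold mixDensity; ring
  simp_rw [h]
  rw [← ofReal_integral_eq_lintegral_ofReal ((integrable_exp_neg_mul_sq hb).const_mul _)
    (.of_forall fun t => by positivity), integral_const_mul, integral_gaussian,
    ← Real.sqrt_mul (by positivity), div_mul_div_cancel₀ Real.pi_ne_zero, div_self hb.ne']
  simp⟩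

/-! ### Characteristic functions of the mixtures -/

/-- The Fourier transform of `exp (-b t²)`. -/
def gaussTransform (b s : ℝ) : ℂ :=
  (Real.pi / b : ℂ) ^ (1 / 2 : ℂ) * Complex.exp (-(s : ℂ) ^ 2 / (4 * b))

theorem gaussTransform_ne_zero {b : ℝ} (hb : 0 < b) (s : ℝ) : gaussTransform b s ≠ 0 := by
  refine mul_ne_zero ?_ (Complex.exp_ne_zero _)
  rw [Complex.cpow_ne_zero_iff]
  left
  exact div_ne_zero (by exact_mod_cast Real.pi_ne_zero) (by exact_mod_cast hb.ne')

theorem gaussTransform_eq (b s : ℝ) :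
    gaussTransform b s = gaussTransform b 0 * (Real.exp (-s ^ 2 / (4 * b)) : ℝ) := by
  simp [gaussTransform]

theorem integral_exp_mixMeasure {b : ℝ} (hb : 0 < b) {ε : ℝ} (hε : -1 ≤ ε) (s : ℝ) :
    ∫ t, (Circle.exp (s * t) : ℂ) ∂(mixMeasure b ε) =
      (√(b / Real.pi) / 2 : ℝ) * (gaussTransform b s + ε * gaussTransform (2 * b) s) := by
  have hF : ∀ {b : ℝ}, 0 < b → ∫ t : ℝ, Complex.exp (Complex.I * s * t) *
      Complex.exp (-b * t ^ 2) = gaussTransform b s := fun {b} hb =>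
    fourierIntegral_gaussian (b := (b : ℂ)) (by simpa using hb) s
  have hI : ∀ {b : ℝ}, 0 < b → Integrable fun t : ℝ => Complex.exp (Complex.I * s * t) *
      Complex.exp (-b * t ^ 2) := fun {b} hb => by
    have := integrable_cexp_quadratic (b := (b : ℂ)) (by simpa using hb) (Complex.I * s) 0
    refine this.congr (.of_forall fun t => ?_)
    simp only [add_zero]
    rw [add_comm, Complex.exp_add]
  have h2b : 0 < 2 * b := by positivity
  rw [mixMeasure, integral_withDensity_eq_integral_toReal_smul (by fun_prop) (by simp),
    ← hF hb, ← hF h2b, ← integral_const_mul, ← integral_add (hI hb) ((hI h2b).const_mul _),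
    ← integral_const_mul]
  refine integral_congr_ae (.of_forall fun t => ?_)
  change (ENNReal.ofReal (mixDensity b ε t)).toReal • _ = _
  rw [ENNReal.toReal_ofReal (mixDensity_nonneg hb hε t), mixDensity, Circle.coe_exp,
    Complex.real_smul]
  push_cast
  rw [show (s : ℂ) * t * Complex.I = Complex.I * s * t by ring]
  ring

/-- Here `s` is the frequency of `y` along the curve, and the value of `y` at `(0, -1)` is `±1`.
That sign selects which of the two Gaussian transforms survives, whence nonvanishing. -/
theorem charFn_mixture {b : ℝ} (hb : 0 < b) (d : ℝ) {y : CharGroup RT} {s : ℝ}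
    (hs : ∀ t, pairing (embed d 1 t) y = Circle.exp (s * t)) :
    charFn (mixture b d) y = (√(b / Real.pi) / 2 : ℝ) *
      ((1 + pairing (embed d circleNegOne 0) y) * gaussTransform b s +
        (1 - pairing (embed d circleNegOne 0) y) * gaussTransform (2 * b) s) := by
  have := isFiniteMeasure_mixMeasure hb 1
  have := isFiniteMeasure_mixMeasure hb (-1)
  have hneg : ∀ t, pairing (embed d circleNegOne t) y =
      pairing (embed d circleNegOne 0) y * Circle.exp (s * t) := fun t => by
    rw [← hs, ← pairing_add, embed_add, mul_one, zero_add]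
  rw [charFn, mixture, integral_add_measure (integrable_pairing _ y) (integrable_pairing _ y),
    integral_map (by fun_prop) (continuous_pairing y).aestronglyMeasurable,
    integral_map (by fun_prop) (continuous_pairing y).aestronglyMeasurable]
  rw [integral_congr_ae (.of_forall hneg), integral_congr_ae (.of_forall hs), integral_const_mul, integral_exp_mixMeasure hb (by norm_num),
    integral_exp_mixMeasure hb le_rfl]
  push_cast
  ring

theorem charFn_mixture_ne_zero {b : ℝ} (hb : 0 < b) (d : ℝ) (y : CharGroup RT) :
    charFn (mixture b d) y ≠ 0 := by
  obtain ⟨s, hs⟩ := exists_eq_circleExp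
    (f := fun t : ℝ => y (Multiplicative.ofAdd (embed d 1 t)))
    ((map_continuous y).comp (continuous_ofAdd.comp (continuous_embed d 1)))
    (fun x x' => by rw [← map_mul, ← ofAdd_add, embed_add, mul_one])
  rw [charFn_mixture hb d (s := s) fun t => congrArg _ (hs t)]
  have hη : pairing (embed d circleNegOne 0) y * pairing (embed d circleNegOne 0) y = 1 := by
    rw [← pairing_add, embed_add, circleNegOne_mul_self, add_zero]
    simp [embed, ← pairing_zero y]
    rfl
  have hc : ((√(b / Real.pi) / 2 : ℝ) : ℂ) ≠ 0 := by
    have : 0 < √(b / Real.pi) / 2 := by positivity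
    exact_mod_cast this.ne'
  refine mul_ne_zero hc ?_
  rcases mul_self_eq_one_iff.mp hη with h | h <;> rw [h]
  · simpa using gaussTransform_ne_zero hb s
  · have := gaussTransform_ne_zero (b := 2 * b) (by positivity) s
    norm_num
    exact this

theorem lineChar_zero : lineChar 0 = 1 :=
  charGroup_ext fun x => by simp [pairing_lineChar, pairing_one]

/-- Along `lineChar s` the decay is `exp (-s²/(4b))`, but along the coset `twistChar d * lineChar s`
it is `exp (-s²/(8b))`. The parallelogram identity for the moduli would require equal rates. -/
theorem mixture_ne_conv {b : ℝ} (hb : 0 < b) (d : ℝ) {γ ρ : Measure RT}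
    (hγ : IsGaussianDistribution γ) (hρ : IsDistributionOn (orderTwoSubgroup RT) ρ) :
    mixture b d ≠ γ.conv ρ := by
  intro h
  have := isProbabilityMeasure_mixture hb d
  have key := norm_charFn_conv_parallelogram hγ hρ (twistChar d) (lineChar 1)
  have hsq : lineChar 1 ^ 2 = lineChar 2 := by rw [sq, ← lineChar_add]; norm_num
  have hdiv : twistChar d / lineChar 2 = twistChar d * lineChar (-2) := by
    rw [div_eq_iff_eq_mul, mul_assoc, ← lineChar_add, neg_add_cancel, lineChar_zero, mul_one]
  rw [hsq, hdiv, ← h] at key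
  have htw : ∀ z t, pairing (embed d z t) (twistChar d) = z := fun z t => by
    rw [pairing_twistChar, ← Circle.coe_mul]
    simp [embed, mul_assoc]
  set C : ℂ := ((√(b / Real.pi) / 2 : ℝ) : ℂ)
  have hline : ∀ s, charFn (mixture b d) (lineChar s) = C * (2 * gaussTransform b s) := fun s => by
    rw [charFn_mixture hb d (s := s) fun t => by rw [pairing_lineChar]; rfl, pairing_lineChar]
    simp only [embed, mul_zero, Circle.exp_zero, Circle.coe_one]
    ring
  have htwist : ∀ s, charFn (mixture b d) (twistChar d * lineChar s) =
      C * (2 * gaussTransform (2 * b) s) := fun s => by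
    rw [charFn_mixture hb d (s := s) fun t => by
      rw [pairing_mul, htw, pairing_lineChar, Circle.coe_one, one_mul]; rfl, pairing_mul, htw,
      coe_circleNegOne, pairing_lineChar]
    simp only [embed, mul_zero, Circle.exp_zero, Circle.coe_one]
    ring
  have hnorm := hline 0
  rw [lineChar_zero, charFn_one] at hnorm
  have htw0 := htwist 0
  rw [lineChar_zero, mul_one] at htw0
  have hl : charFn (mixture b d) (lineChar 2) = (Real.exp (-2 ^ 2 / (4 * b)) : ℝ) := by
    rw [hline, gaussTransform_eq, ← mul_assoc, ← mul_assoc, mul_assoc C, ← hnorm, one_mul]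
  have ht : ∀ s, charFn (mixture b d) (twistChar d * lineChar s) =
      charFn (mixture b d) (twistChar d) * (Real.exp (-s ^ 2 / (4 * (2 * b))) : ℝ) := fun s => by
    rw [htwist, gaussTransform_eq, htw0]
    ring
  have hne := norm_ne_zero_iff.mpr (charFn_mixture_ne_zero hb d (twistChar d))
  rw [hl, ht, ht] at key
  simp only [norm_mul, Complex.norm_real, Real.norm_eq_abs, Real.abs_exp] at key
  rw [mul_mul_mul_comm, ← sq, ← Real.exp_add, ← Real.exp_nat_mul] at key
  have := Real.exp_injective (mul_left_cancel₀ (pow_ne_zero 2 hne) key)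
  field_simp at this
  norm_num at this

/-! ### Symmetry of the mixtures -/

theorem map_withDensity_of_invariant {Ω : Type*} [MeasurableSpace Ω] {μ : Measure Ω} {T : Ω → Ω}
    (hT : MeasurePreserving T μ μ) {W : Ω → ENNReal} (hW : Measurable W)
    (hinv : ∀ ω, W (T ω) = W ω) : (μ.withDensity W).map T = μ.withDensity W := by
  ext s hs
  rw [Measure.map_apply hT.measurable hs, withDensity_apply _ (hT.measurable hs),
    withDensity_apply _ hs, ← hT.setLIntegral_comp_preimage hs hW]
  simp_rw [hinv]

/-- The linear involution of the plane that preserves `x + y` and changes the sign of `x + a y`. -/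
def reflection (a : ℝ) : ℝ × ℝ →ₗ[ℝ] ℝ × ℝ where
  toFun p := (-((1 + a) * p.1 + 2 * a * p.2) / (1 - a), (2 * p.1 + (1 + a) * p.2) / (1 - a))
  map_add' p q := by ext <;> simp <;> ring
  map_smul' r p := by ext <;> simp <;> ring

theorem reflection_apply (a : ℝ) (p : ℝ × ℝ) : reflection a p =
    (-((1 + a) * p.1 + 2 * a * p.2) / (1 - a), (2 * p.1 + (1 + a) * p.2) / (1 - a)) := rfl

theorem reflection_sum {a : ℝ} (ha : 1 - a ≠ 0) (p : ℝ × ℝ) :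
    (reflection a p).1 + (reflection a p).2 = p.1 + p.2 := by
  simp only [reflection_apply]; field_simp; ring

theorem reflection_weighted_sum {a : ℝ} (ha : 1 - a ≠ 0) (p : ℝ × ℝ) :
    (reflection a p).1 + a * (reflection a p).2 = -(p.1 + a * p.2) := by
  simp only [reflection_apply]; field_simp; ring

theorem reflection_quadratic {a : ℝ} (ha : 1 - a ≠ 0) (p : ℝ × ℝ) :
    (reflection a p).1 ^ 2 - a * (reflection a p).2 ^ 2 = p.1 ^ 2 - a * p.2 ^ 2 := by
  simp only [reflection_apply]; field_simp; ring

/-- A linear involution has determinant `±1`. -/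
theorem measurePreserving_reflection {a : ℝ} (ha : 1 - a ≠ 0) :
    MeasurePreserving (reflection a) (volume : Measure (ℝ × ℝ)) volume := by
  have hinv : reflection a ∘ₗ reflection a = LinearMap.id := by
    refine LinearMap.ext fun p => Prod.ext ?_ ?_ <;>
      simp only [LinearMap.comp_apply, LinearMap.id_apply, reflection_apply] <;> field_simp <;> ring
  have hdet : LinearMap.det (reflection a) * LinearMap.det (reflection a) = 1 := by
    rw [← LinearMap.det_comp, hinv, LinearMap.det_id]
  have habs : |(LinearMap.det (reflection a))⁻¹| = 1 := by
    rcases mul_self_eq_one_iff.mp hdet with h | h <;> simp [h]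
  refine ⟨(LinearMap.continuous_of_finiteDimensional _).measurable, ?_⟩
  rw [Measure.map_linearMap_addHaar_eq_smul_addHaar _ (left_ne_zero_of_mul_eq_one hdet), habs]
  simp

theorem prod_mixMeasure (b₁ b₂ ε₁ ε₂ : ℝ) :
    (mixMeasure b₁ ε₁).prod (mixMeasure b₂ ε₂) = (volume : Measure (ℝ × ℝ)).withDensity
      fun p => ENNReal.ofReal (mixDensity b₁ ε₁ p.1) * ENNReal.ofReal (mixDensity b₂ ε₂ p.2) :=
  prod_withDensity (by fun_prop) (by fun_prop)

instance (b ε : ℝ) : SFinite (mixMeasure b ε) := by unfold mixMeasure; infer_instance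

/-- Summing over `(ε, δ)` and `(-ε, -δ)`, the pairs with the same product, cancels the mixed terms.
What remains depends on `p.1 ^ 2 - a * p.2 ^ 2`, which the reflection preserves. -/
theorem map_reflection_mixMeasure {a : ℝ} (ha : a < 0) {ε δ : ℝ} (hε : ε = 1 ∨ ε = -1)
    (hδ : δ = 1 ∨ δ = -1) :
    ((mixMeasure 1 ε).prod (mixMeasure (-a) δ) +
        (mixMeasure 1 (-ε)).prod (mixMeasure (-a) (-δ))).map (reflection a) =
      (mixMeasure 1 ε).prod (mixMeasure (-a) δ) +
        (mixMeasure 1 (-ε)).prod (mixMeasure (-a) (-δ)) := by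
  have ha' : 1 - a ≠ 0 := by linarith
  have hε1 : -1 ≤ ε := by rcases hε with rfl | rfl <;> norm_num
  have hε2 : -1 ≤ -ε := by rcases hε with rfl | rfl <;> norm_num
  have hδ1 : -1 ≤ δ := by rcases hδ with rfl | rfl <;> norm_num
  have hδ2 : -1 ≤ -δ := by rcases hδ with rfl | rfl <;> norm_num
  have ha0 : 0 < -a := by linarith
  rw [prod_mixMeasure, prod_mixMeasure, ← withDensity_add_left (by fun_prop)]
  refine map_withDensity_of_invariant (measurePreserving_reflection ha') (by fun_prop) fun p => ?_
  have hW : ∀ p : ℝ × ℝ, ENNReal.ofReal (mixDensity 1 ε p.1) *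
        ENNReal.ofReal (mixDensity (-a) δ p.2) + ENNReal.ofReal (mixDensity 1 (-ε) p.1) *
        ENNReal.ofReal (mixDensity (-a) (-δ) p.2) =
      ENNReal.ofReal (√(1 / Real.pi) / 2 * (√(-a / Real.pi) / 2) *
        (2 * (Real.exp (-(p.1 ^ 2 - a * p.2 ^ 2)) +
          ε * δ * Real.exp (-2 * (p.1 ^ 2 - a * p.2 ^ 2))))) := fun p => by
    rw [← ENNReal.ofReal_mul (mixDensity_nonneg one_pos hε1 _),
      ← ENNReal.ofReal_mul (mixDensity_nonneg one_pos hε2 _),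
      ← ENNReal.ofReal_add
        (mul_nonneg (mixDensity_nonneg one_pos hε1 _) (mixDensity_nonneg ha0 hδ1 _))
        (mul_nonneg (mixDensity_nonneg one_pos hε2 _) (mixDensity_nonneg ha0 hδ2 _))]
    congr 1
    have e1 : Real.exp (-(p.1 ^ 2 - a * p.2 ^ 2)) =
        Real.exp (-1 * p.1 ^ 2) * Real.exp (-(-a) * p.2 ^ 2) := by
      rw [← Real.exp_add]; ring_nf
    have e2 : Real.exp (-2 * (p.1 ^ 2 - a * p.2 ^ 2)) =
        Real.exp (-(2 * 1) * p.1 ^ 2) * Real.exp (-(2 * -a) * p.2 ^ 2) := by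
      rw [← Real.exp_add]; ring_nf
    rw [e1, e2, mixDensity, mixDensity, mixDensity, mixDensity]
    ring
  simp only [Pi.add_apply]
  rw [hW, hW, reflection_quadratic ha']

theorem mixture_symmetric {α : RT ≃ₜ+ RT} {a c d : ℝ} (ha : a < 0)
    (hline : ∀ t : ℝ, α (t, 0) = (a * t, Additive.ofMul (Circle.exp (c * t))))
    (hcirc : ∀ z, α (0, z) = (0, z)) (hd : c + d = d * a) :
    ((mixture 1 d).prod (mixture (-a) d)).map (fun p => (p.1 + p.2, p.1 + α p.2)) =
      ((mixture 1 d).prod (mixture (-a) d)).map (fun p => (p.1 + p.2, -(p.1 + α p.2))) := by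
  have ha' : 1 - a ≠ 0 := by linarith
  have hαm : Measurable α := (map_continuous α).measurable
  have hT : Measurable (reflection a) := (measurePreserving_reflection ha').measurable
  let B : Circle → ℝ × ℝ → RT × RT := fun z p => (embed d z (p.1 + p.2), embed d z (p.1 + a * p.2))
  have hB : ∀ z, Measurable (B z) := fun z => by fun_prop
  have e1 : ∀ (ν ν' : Measure ℝ) [SFinite ν] [SFinite ν'] (z w : Circle),
      ((ν.map (embed d z)).prod (ν'.map (embed d w))).map (fun p => (p.1 + p.2, p.1 + α p.2)) =
        (ν.prod ν').map (B (z * w)) := fun ν ν' _ _ z w => by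
    rw [Measure.map_prod_map _ _ (by fun_prop) (by fun_prop),
      Measure.map_map (by fun_prop) (by fun_prop)]
    congr 1
    ext1 p
    simp only [Function.comp_apply, Prod.map, automorphism_embed hline hcirc hd, embed_add, B]
  have e2 : ∀ (ν ν' : Measure ℝ) [SFinite ν] [SFinite ν'] (z w : Circle),
      (z * w) * (z * w) = 1 →
      ((ν.map (embed d z)).prod (ν'.map (embed d w))).map
        (fun p => (p.1 + p.2, -(p.1 + α p.2))) =
        ((ν.prod ν').map (reflection a)).map (B (z * w)) := fun ν ν' _ _ z w hzw => by
    rw [Measure.map_prod_map _ _ (by fun_prop) (by fun_prop),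
      Measure.map_map (by fun_prop) (by fun_prop), Measure.map_map (hB _) hT]
    congr 1
    ext1 p
    simp only [Function.comp_apply, Prod.map, automorphism_embed hline hcirc hd, embed_add, B,
      neg_embed d hzw, reflection_sum ha', reflection_weighted_sum ha']
  -- The four pieces are grouped by the product of the signs. Both sums lie on the curve with that
  -- sign, and so does the negated second sum, because the sign is its own inverse.
  have hsplit : (mixture 1 d).prod (mixture (-a) d) =
      ((mixMeasure 1 1).map (embed d 1)).prod ((mixMeasure (-a) 1).map (embed d 1)) +
      ((mixMeasure 1 (-1)).map (embed d circleNegOne)).prod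
        ((mixMeasure (-a) (-1)).map (embed d circleNegOne)) +
      (((mixMeasure 1 1).map (embed d 1)).prod
        ((mixMeasure (-a) (-1)).map (embed d circleNegOne)) +
      ((mixMeasure 1 (-1)).map (embed d circleNegOne)).prod
        ((mixMeasure (-a) 1).map (embed d 1))) := by
    rw [mixture, mixture, Measure.prod_add, Measure.add_prod, Measure.add_prod]
    abel
  have r1 := map_reflection_mixMeasure ha (.inl rfl : (1 : ℝ) = 1 ∨ (1 : ℝ) = -1)
    (.inl rfl : (1 : ℝ) = 1 ∨ (1 : ℝ) = -1)
  have r2 := map_reflection_mixMeasure ha (.inl rfl : (1 : ℝ) = 1 ∨ (1 : ℝ) = -1)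
    (.inr rfl : (-1 : ℝ) = 1 ∨ (-1 : ℝ) = -1)
  rw [neg_neg] at r2
  have hn := circleNegOne_mul_self
  rw [hsplit]
  simp only [Measure.map_add _ _ (show Measurable fun p : RT × RT => (p.1 + p.2, p.1 + α p.2) by
      fun_prop), Measure.map_add _ _
      (show Measurable fun p : RT × RT => (p.1 + p.2, -(p.1 + α p.2)) by fun_prop)]
  rw [e1, e1, e1, e1, e2 _ _ _ _ (by simp), e2 _ _ _ _ (by simp [hn]),
    e2 _ _ _ _ (by simp [hn]), e2 _ _ _ _ (by simp [hn]), hn, mul_one, one_mul, mul_one,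
    ← Measure.map_add _ _ (hB _), ← Measure.map_add _ _ (hB _), ← Measure.map_add _ _ (hB _),
    ← Measure.map_add _ _ (hB _), ← Measure.map_add _ _ hT, ← Measure.map_add _ _ hT, r1, r2]

/-- If `α` acts identically on `𝕋` and by a negative multiplication on `ℝ`, there are
distributions satisfying the symmetry condition that are not convolutions of Gaussian
distributions and distributions on the subgroup of order two. -/
theorem exists_mixture_counterexample {α : RT ≃ₜ+ RT} {a c : ℝ} (ha : a < 0)
    (hline : ∀ t : ℝ, α (t, 0) = (a * t, Additive.ofMul (Circle.exp (c * t))))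
    (hcirc : ∀ z, α (0, z) = (0, z)) :
    ∃ μ₁ μ₂ : Measure RT, IsProbabilityMeasure μ₁ ∧ IsProbabilityMeasure μ₂ ∧
      (∀ y, charFn μ₁ y ≠ 0) ∧ (∀ y, charFn μ₂ y ≠ 0) ∧
      (μ₁.prod μ₂).map (fun p => (p.1 + p.2, p.1 + α p.2)) =
        (μ₁.prod μ₂).map (fun p => (p.1 + p.2, -(p.1 + α p.2))) ∧
      ∀ γ ρ, IsGaussianDistribution γ → IsDistributionOn (orderTwoSubgroup RT) ρ →
        μ₁ ≠ γ.conv ρ := by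
  have ha0 : 0 < -a := by linarith
  have ha1 : a - 1 ≠ 0 := by linarith
  -- The twist `c / (a - 1)` solves `c + d = d * a`; the rates `1` and `-a` are the coefficients of
  -- the form `x² - a y²`, positive because `a < 0`.
  exact ⟨mixture 1 (c / (a - 1)), mixture (-a) (c / (a - 1)),
    isProbabilityMeasure_mixture one_pos _, isProbabilityMeasure_mixture ha0 _,
    charFn_mixture_ne_zero one_pos _, charFn_mixture_ne_zero ha0 _,
    mixture_symmetric ha hline hcirc (by field_simp; ring),
    fun _ _ hγ hρ => mixture_ne_conv one_pos _ hγ hρ⟩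

/-- Distributions with a symmetric conditional law are realized by independent random variables
on a probability space in any universe. -/
theorem exists_indep_realization {α : RT ≃ₜ+ RT} {μ₁ μ₂ : Measure RT} [IsProbabilityMeasure μ₁]
    [IsProbabilityMeasure μ₂]
    (h : (μ₁.prod μ₂).map (fun p => (p.1 + p.2, p.1 + α p.2)) =
        (μ₁.prod μ₂).map (fun p => (p.1 + p.2, -(p.1 + α p.2)))) :
    ∃ (Ω : Type*) (_ : MeasurableSpace Ω) (P : Measure Ω) (_ : IsProbabilityMeasure P)
      (ξ₁ ξ₂ : Ω → RT), Measurable ξ₁ ∧ Measurable ξ₂ ∧ IndepFun ξ₁ ξ₂ P ∧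
        P.map ξ₁ = μ₁ ∧ P.map ξ₂ = μ₂ ∧
        SymmetricCondDistrib P (fun ω => ξ₁ ω + α (ξ₂ ω)) (fun ω => ξ₁ ω + ξ₂ ω) := by
  have hup : Measurable (ULift.up : RT × RT → ULift (RT × RT)) := measurable_up
  let P := (μ₁.prod μ₂).map (ULift.up : RT × RT → ULift (RT × RT))
  have hP : IsProbabilityMeasure P := Measure.isProbabilityMeasure_map hup.aemeasurable
  have h1 : Measurable fun ω : ULift (RT × RT) => ω.down.1 := measurable_fst.comp measurable_down
  have h2 : Measurable fun ω : ULift (RT × RT) => ω.down.2 := measurable_snd.comp measurable_down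
  have m1 : P.map (fun ω => ω.down.1) = μ₁ := by
    rw [Measure.map_map h1 hup]
    exact (measurePreserving_fst (μ := μ₁) (ν := μ₂)).map_eq
  have m2 : P.map (fun ω => ω.down.2) = μ₂ := by
    rw [Measure.map_map h2 hup]
    exact (measurePreserving_snd (μ := μ₁) (ν := μ₂)).map_eq
  have hind : IndepFun (fun ω : ULift (RT × RT) => ω.down.1) (fun ω => ω.down.2) P := by
    rw [indepFun_iff_map_prod_eq_prod_map_map h1.aemeasurable h2.aemeasurable, m1, m2,
      Measure.map_map (h1.prodMk h2) hup]
    exact Measure.map_id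
  refine ⟨_, inferInstance, P, hP, _, _, h1, h2, hind, m1, m2, ?_⟩
  rwa [symmetricCondDistrib_iff_prod P α h1 h2 hind, m1, m2]

end Heyde

end

theorem proposition3p1 :
    ¬ ∃ α : Heyde.RT ≃ₜ+ Heyde.RT,
      (∀ (Ω : Type*) [MeasurableSpace Ω] (P : Measure Ω) [IsProbabilityMeasure P]
          (ξ₁ ξ₂ : Ω → Heyde.RT),
          Measurable ξ₁ → Measurable ξ₂ → IndepFun ξ₁ ξ₂ P →
          (∀ y, Heyde.charFn (P.map ξ₁) y ≠ 0) →
          (∀ y, Heyde.charFn (P.map ξ₂) y ≠ 0) →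
          Heyde.SymmetricCondDistrib P
            (fun ω => ξ₁ ω + α (ξ₂ ω)) (fun ω => ξ₁ ω + ξ₂ ω) →
          ∃ γ₁ γ₂ ρ₁ ρ₂ : Measure Heyde.RT,
            Heyde.IsGaussianDistribution γ₁ ∧ Heyde.IsGaussianDistribution γ₂ ∧
            Heyde.IsDistributionOn (Heyde.orderTwoSubgroup Heyde.RT) ρ₁ ∧
            Heyde.IsDistributionOn (Heyde.orderTwoSubgroup Heyde.RT) ρ₂ ∧
            P.map ξ₁ = γ₁.conv ρ₁ ∧ P.map ξ₂ = γ₂.conv ρ₂) ∧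
      (∃ (Ω : Type*) (_ : MeasurableSpace Ω) (P : Measure Ω) (_ : IsProbabilityMeasure P)
          (ξ₁ ξ₂ : Ω → Heyde.RT) (γ₁ γ₂ ρ₁ ρ₂ : Measure Heyde.RT),
          Measurable ξ₁ ∧ Measurable ξ₂ ∧ IndepFun ξ₁ ξ₂ P ∧
          Heyde.IsGaussianDistribution γ₁ ∧ Heyde.IsGaussianDistribution γ₂ ∧
          ¬ Heyde.IsDegenerate γ₁ ∧ ¬ Heyde.IsDegenerate γ₂ ∧
          Heyde.IsDistributionOn (Heyde.orderTwoSubgroup Heyde.RT) ρ₁ ∧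
          Heyde.IsDistributionOn (Heyde.orderTwoSubgroup Heyde.RT) ρ₂ ∧
          P.map ξ₁ = γ₁.conv ρ₁ ∧ P.map ξ₂ = γ₂.conv ρ₂ ∧
          Heyde.SymmetricCondDistrib P
            (fun ω => ξ₁ ω + α (ξ₂ ω)) (fun ω => ξ₁ ω + ξ₂ ω)) := by

  rintro ⟨α, h₁, Ω, mΩ, P, hP, ξ₁, ξ₂, γ₁, γ₂, ρ₁, ρ₂, hξ₁, hξ₂, hind, hγ₁, hγ₂, -, hdeg, hρ₁, hρ₂,
    hμ₁, hμ₂, hsym⟩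
  -- Statement 1 in terms of laws alone; the decomposition of the first law is enough for the
  -- contradictions.
  have key : ∀ μ₁ μ₂ : Measure Heyde.RT, IsProbabilityMeasure μ₁ → IsProbabilityMeasure μ₂ →
      (∀ y, Heyde.charFn μ₁ y ≠ 0) → (∀ y, Heyde.charFn μ₂ y ≠ 0) →
      (μ₁.prod μ₂).map (fun p => (p.1 + p.2, p.1 + α p.2)) =
        (μ₁.prod μ₂).map (fun p => (p.1 + p.2, -(p.1 + α p.2))) →
      ∃ γ ρ, Heyde.IsGaussianDistribution γ ∧
        Heyde.IsDistributionOn (Heyde.orderTwoSubgroup Heyde.RT) ρ ∧ μ₁ = γ.conv ρ := by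
    intro μ₁ μ₂ _ _ hn₁ hn₂ h
    obtain ⟨Ω, _, P, _, ξ₁, ξ₂, hξ₁, hξ₂, hind, rfl, rfl, hsym⟩ := Heyde.exists_indep_realization h
    obtain ⟨γ₁, γ₂, ρ₁, ρ₂, hγ₁, -, hρ₁, -, heq, -⟩ := h₁ Ω P ξ₁ ξ₂ hξ₁ hξ₂ hind hn₁ hn₂ hsym
    exact ⟨γ₁, ρ₁, hγ₁, hρ₁, heq⟩
  obtain ⟨a, c, ha, hline, hcirc | hcirc⟩ := Heyde.exists_automorphism_params α
  · rcases ha.lt_or_gt with ha | ha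
    · obtain ⟨μ₁, μ₂, hp₁, hp₂, hn₁, hn₂, h, hne⟩ :=
        Heyde.exists_mixture_counterexample ha hline hcirc
      obtain ⟨γ, ρ, hγ, hρ, heq⟩ := key μ₁ μ₂ hp₁ hp₂ hn₁ hn₂ h
      exact hne γ ρ hγ hρ heq
    · rw [Heyde.symmetricCondDistrib_iff_prod P α hξ₁ hξ₂ hind, hμ₁, hμ₂] at hsym
      exact hdeg (Heyde.isDegenerate_of_symmetric ha hline hcirc hγ₁ hγ₂ hρ₁ hρ₂ hsym)
  · obtain ⟨μ, hp, hn, h, hne⟩ := Heyde.exists_circle_counterexample hcirc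
    obtain ⟨γ, ρ, hγ, hρ, heq⟩ := key μ μ hp hp hn hn h
    exact hne γ ρ hγ hρ heq
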